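/- A ring $R$ (associative, with $1$) with center $C$ is called centrally essential if $R$, regarded as a module over $C$, is an essential extension of its submodule $C$, i.e. every nonzero $C$-submodule of $R$ has nonzero intersection with $C$. **Theorem 1.1.** Let $F$ be a field of characteristic $p>0$. 1. If $G$ is an arbitrary finite group, then the group algebra $FG$ is a centrally essential ring if and only if $G=P\times H$ (internal direct product of subgroups), where $P$ is the unique Sylow $p$-subgroup of $G$, the subgroup $H$ is commutative, and the ring $FP$ is centrally essential. 2. If $G$ is a finite $p$-group whose nilpotency class does not exceed $2$, then the group algebra $FG$ is a centrally essential ring. 3. There exists a group $G$ of order $p^5$ such that the group algebra $FG$ is not a centrally essential ring. -/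

import Mathlib

/-- A submodule `N` of `M` is essential (equivalently `M` is an essential extension of `N`)
if every nonzero submodule of `M` meets `N` nontrivially. -/
def IsEssentialSubmodule {C M : Type*} [Semiring C] [AddCommMonoid M] [Module C M]
    (N : Submodule C M) : Prop :=
  ∀ K : Submodule C M, K ≠ ⊥ → N ⊓ K ≠ ⊥

/-- A ring `R` with center `C` is centrally essential if `R`, as a module over `C`, is an
essential extension of its submodule `C`. (Elements of `C` are central, so left and right
multiplication by them agree, and it does not matter on which side `C` acts.) -/
def IsCentrallyEssential (R : Type*) [Ring R] : Prop :=
  IsEssentialSubmodule (LinearMap.range (Algebra.linearMap (Subring.center R) R))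

/-- `G` is the (internal) direct product of its subgroups `P` and `H`: both are normal,
they intersect trivially, and together they generate `G`. -/
def IsInternalDirectProduct {G : Type*} [Group G] (P H : Subgroup G) : Prop :=
  P.Normal ∧ H.Normal ∧ P ⊓ H = ⊥ ∧ P ⊔ H = ⊤

/-! Central essentiality makes idempotents central. This descends to the finite ring `𝔽_p[G]`, where
it makes the nilpotents the radical and every residue ring a finite domain, hence a field. So `g -
1` is nilpotent for each commutator `g`, and the commutator subgroup is a `p`-group inside a normal
Sylow subgroup `P`. A Schur–Zassenhaus complement `H` is normal because its averaging idempotent is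
central, and abelian because its commutators lie in `P ⊓ H`. Then `F[G] = F[P][H]`, and the property
is transferred between `F[P]` and `F[P][H]`.

In class at most 2, some nonzero central multiple of `x` is constant on cosets of `Z(G)`, which
contains all commutators, so it is a class function. The group of order `p^5` fails because every
central multiple of one coset sum is supported on a coset of which no element has its whole
conjugacy class inside. -/

theorem isCentrallyEssential_iff {R : Type*} [Ring R] :
    IsCentrallyEssential R ↔
      ∀ x : R, x ≠ 0 → ∃ c ∈ Subring.center R, c * x ∈ Subring.center R ∧ c * x ≠ 0 := by
  constructor
  · intro h x hx
    have hK : Submodule.span (Subring.center R) {x} ≠ ⊥ := by simpa using hx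
    obtain ⟨y, hy, hy0⟩ := Submodule.exists_mem_ne_zero_of_ne_bot (h _ hK)
    obtain ⟨⟨d, rfl⟩, hy2⟩ := hy
    obtain ⟨c, hc⟩ := Submodule.mem_span_singleton.1 hy2
    have hc' : (c : R) * x = (d : R) := hc
    refine ⟨c, c.2, hc' ▸ d.2, ?_⟩
    rw [hc']
    exact hy0
  · intro h K hK
    obtain ⟨x, hxK, hx⟩ := Submodule.exists_mem_ne_zero_of_ne_bot hK
    obtain ⟨c, hc, hcx, h0⟩ := h x hx
    refine (Submodule.ne_bot_iff _).2 ⟨c * x, ⟨⟨⟨c * x, hcx⟩, rfl⟩, ?_⟩, h0⟩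
    exact K.smul_mem ⟨c, hc⟩ hxK

theorem RingEquiv.map_mem_center {R S : Type*} [Ring R] [Ring S] (e : R ≃+* S) {c : R}
    (hc : c ∈ Subring.center R) : e c ∈ Subring.center S := by
  rw [Subring.mem_center_iff] at hc ⊢
  intro s
  obtain ⟨r, rfl⟩ := e.surjective s
  rw [← map_mul, ← map_mul, hc r]

theorem IsCentrallyEssential.of_ringEquiv {R S : Type*} [Ring R] [Ring S] (e : R ≃+* S)
    (h : IsCentrallyEssential R) : IsCentrallyEssential S := by
  rw [isCentrallyEssential_iff] at h ⊢
  intro x hx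
  obtain ⟨c, hc, hcx, h0⟩ := h (e.symm x) (by simpa using hx)
  have hm : e c * x = e (c * e.symm x) := by simp
  refine ⟨e c, e.map_mem_center hc, hm ▸ e.map_mem_center hcx, ?_⟩
  rw [hm]
  exact (map_ne_zero_iff e e.injective).2 h0

/-- A central multiple of `e * r * f` absorbs `f` on the right; if it is itself central, that `f`
moves to the left and meets `e`. -/
theorem IsCentrallyEssential.mul_mul_one_sub_eq_zero {R : Type*} [Ring R]
    (h : IsCentrallyEssential R) {e f : R} (hef : f * e = 0) (hf : f * f = f)
    (r : R) : e * r * f = 0 := by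
  by_contra hx
  obtain ⟨c, hc, hcx, h0⟩ := isCentrallyEssential_iff.1 h _ hx
  rw [Subring.mem_center_iff] at hc hcx
  apply h0
  calc c * (e * r * f) = c * (e * r * f) * f := by simp only [mul_assoc, hf]
    _ = f * (c * (e * r * f)) := (hcx f).symm
    _ = (f * c) * (e * r * f) := by simp only [mul_assoc]
    _ = c * (f * e) * r * f := by rw [hc f]; simp only [mul_assoc]
    _ = 0 := by rw [hef]; simp

theorem IsCentrallyEssential.idempotent_mem_center {R : Type*} [Ring R]
    (h : IsCentrallyEssential R) {e : R} (he : IsIdempotentElem e) : e ∈ Subring.center R := by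
  have he' : e * e = e := he
  have h1 : (1 - e) * e = 0 := by rw [sub_mul, he', one_mul, sub_self]
  have h2 : e * (1 - e) = 0 := by rw [mul_sub, he', mul_one, sub_self]
  have h3 : (1 - e) * (1 - e) = 1 - e := he.one_sub
  rw [Subring.mem_center_iff]
  intro r
  have ha := h.mul_mul_one_sub_eq_zero h1 h3 r
  have hb := h.mul_mul_one_sub_eq_zero h2 he' r
  have ha' : e * r = e * r * e := by rw [mul_sub, mul_one, sub_eq_zero] at ha; exact ha
  have hb' : r * e = e * r * e := by
    rw [sub_mul, one_mul, sub_mul, sub_eq_zero] at hb; exact hb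
  rw [hb', ← ha']

/-- A finite `p`-group acting on an additive group of exponent `p` fixes a nonzero element of every
nonzero stable subgroup. -/
theorem IsPGroup.exists_fixed_ne_zero {p : ℕ} [Fact p.Prime] {G V : Type*} [Group G] [Finite G]
    (hG : IsPGroup p G) [AddCommGroup V] [DistribMulAction G V] (hV : ∀ v : V, p • v = 0)
    {v : V} (hv : v ≠ 0) :
    ∃ w ∈ AddSubgroup.closure (MulAction.orbit G v), w ≠ 0 ∧ ∀ g : G, g • w = w := by
  let S := AddSubgroup.closure (MulAction.orbit G v)
  have hS : ∀ (g : G) (w : V), w ∈ S → g • w ∈ S := by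
    intro g w hw
    induction hw using AddSubgroup.closure_induction with
    | mem x hx =>
      obtain ⟨k, rfl⟩ := hx
      exact AddSubgroup.subset_closure ⟨g * k, mul_smul g k v⟩
    | zero => rw [smul_zero]; exact S.zero_mem
    | add x y _ _ hx hy => rw [smul_add]; exact S.add_mem hx hy
    | neg x _ hx => rw [smul_neg]; exact S.neg_mem hx
  let _ : MulAction G S :=
    { smul := fun g w => ⟨g • (w : V), hS g w w.2⟩
      one_smul := fun w => Subtype.ext (one_smul G (w : V))
      mul_smul := fun g k w => Subtype.ext (mul_smul g k (w : V)) }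
  have hvS : v ∈ S := AddSubgroup.subset_closure ⟨1, one_smul G v⟩
  have : AddGroup.FG S := (AddGroup.fg_iff_addSubgroup_fg S).2
    ((AddSubgroup.fg_iff S).2 ⟨_, rfl, Set.finite_range _⟩)
  have htors : IsAddTorsion S := fun w =>
    isOfFinAddOrder_iff_nsmul_eq_zero.2
      ⟨p, (Fact.out : p.Prime).pos, Subtype.ext (hV w)⟩
  have : Finite S := AddCommGroup.finite_of_fg_isAddTorsion S htors
  have hdvd : p ∣ Nat.card S := by
    have ho : addOrderOf (⟨v, hvS⟩ : S) = p :=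
      addOrderOf_eq_prime (Subtype.ext (hV v)) fun h0 => hv (congrArg Subtype.val h0)
    exact ho ▸ addOrderOf_dvd_natCard _
  obtain ⟨w, hw, hw0⟩ := hG.exists_fixed_point_of_prime_dvd_card_of_fixed_point S hdvd
    (a := 0) (fun g => Subtype.ext (smul_zero g))
  exact ⟨w, w.2, fun h0 => hw0 (Subtype.ext h0.symm), fun g => congrArg Subtype.val (hw g)⟩

/-! ### Finite rings with central idempotents -/

theorem Monoid.exists_pow_isIdempotentElem {M : Type*} [Monoid M] [Finite M] (a : M) :
    ∃ n : ℕ, n ≠ 0 ∧ IsIdempotentElem (a ^ n) := by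
  obtain ⟨i, j, hij, h⟩ : ∃ i j : ℕ, i < j ∧ a ^ i = a ^ j := by
    obtain ⟨i, j, hne, h⟩ := Finite.exists_ne_map_eq_of_infinite (fun n : ℕ => a ^ n)
    rcases lt_or_gt_of_ne hne with hlt | hlt
    exacts [⟨i, j, hlt, h⟩, ⟨j, i, hlt, h.symm⟩]
  obtain ⟨d, rfl⟩ := Nat.exists_eq_add_of_lt hij
  have hstep : ∀ m, i ≤ m → ∀ k : ℕ, a ^ (m + k * (d + 1)) = a ^ m := by
    intro m hm k
    induction k with
    | zero => simp
    | succ k ih =>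
      obtain ⟨l, rfl⟩ := Nat.exists_eq_add_of_le hm
      calc a ^ (i + l + (k + 1) * (d + 1)) = a ^ (i + d + 1) * a ^ (l + k * (d + 1)) := by
            rw [← pow_add]; congr 1; ring
        _ = a ^ (i + l + k * (d + 1)) := by rw [← h, ← pow_add]; congr 1; ring
        _ = a ^ (i + l) := ih
  -- A multiple of the period `d + 1` that is at least the preperiod `i`.
  refine ⟨(i + 1) * (d + 1), by positivity, ?_⟩
  rw [IsIdempotentElem, ← pow_add]
  exact hstep _ (by nlinarith) _

theorem isNilpotent_mul_one_sub_pow {R : Type*} [Ring R] {x : R} {n : ℕ}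
    (hn : n ≠ 0)   (he : IsIdempotentElem (x ^ n)) : IsNilpotent (x * (1 - x ^ n)) := by
  have hc : Commute x (1 - x ^ n) := (Commute.one_right x).sub_right (Commute.self_pow x n)
  refine ⟨n, ?_⟩
  rw [hc.mul_pow, he.one_sub.pow_eq hn, mul_sub, mul_one, he.eq, sub_self]

section FiniteRing

variable {R : Type*} [Ring R] [Finite R]

/-- An idempotent power `e = w * x` of `y * x` is central, so `e = w ^ k * e * x ^ k` for all `k`,
which vanishes with `x ^ k`. -/
theorem IsNilpotent.mul_left_of_finite
    (hR : ∀ e : R, IsIdempotentElem e → e ∈ Subring.center R) {x : R} (hx : IsNilpotent x) (y : R) :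
    IsNilpotent (y * x) := by
  obtain ⟨n, hn, he⟩ := Monoid.exists_pow_isIdempotentElem (y * x)
  have hc := Subring.mem_center_iff.1 (hR _ he)
  obtain ⟨w, hw⟩ : ∃ w, (y * x) ^ n = w * x := by
    obtain ⟨m, rfl⟩ := Nat.exists_eq_succ_of_ne_zero hn
    exact ⟨(y * x) ^ m * y, by rw [_root_.pow_succ, mul_assoc]⟩
  refine ⟨n, ?_⟩
  generalize (y * x) ^ n = e at he hc hw
  have he' : e * e = e := he
  have key : ∀ k : ℕ, e = w ^ k * e * x ^ k := by
    intro k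
    induction k with
    | zero => simp
    | succ k ih =>
      calc e = w ^ k * (e * e) * x ^ k := by rw [he']; exact ih
        _ = w ^ k * (w * x * e) * x ^ k := by rw [← hw]
        _ = w ^ (k + 1) * (x * e) * x ^ k := by rw [_root_.pow_succ]; simp only [mul_assoc]
        _ = w ^ (k + 1) * e * x ^ (k + 1) := by rw [hc x, _root_.pow_succ' x]; simp only [mul_assoc]
  obtain ⟨k, hk⟩ := hx
  rw [key k, hk, mul_zero]

theorem IsNilpotent.mul_right_of_finite
    (hR : ∀ e : R, IsIdempotentElem e → e ∈ Subring.center R) {x : R} (hx : IsNilpotent x) (y : R) :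
    IsNilpotent (x * y) := by
  obtain ⟨n, hn⟩ := hx.mul_left_of_finite hR y
  refine ⟨n + 1, ?_⟩
  have : (x * y) ^ (n + 1) = x * (y * x) ^ n * y := by
    rw [_root_.pow_succ, ← mul_assoc]
    congr 1
    have : SemiconjBy x (y * x) (x * y) := by simp [SemiconjBy, mul_assoc]
    exact (this.pow_right n).eq.symm
  rw [this, hn, mul_zero, zero_mul]

/-- Identifies the nilpotents with the Jacobson radical; in particular they are closed under
addition. -/
theorem isNilpotent_iff_forall_mem_isMaximal
    (hR : ∀ e : R, IsIdempotentElem e → e ∈ Subring.center R) {x : R} :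
    IsNilpotent x ↔ ∀ m : Ideal R, m.IsMaximal → x ∈ m := by
  constructor
  · intro hx m hm
    by_contra hxm
    obtain ⟨y, t, ht, hyt⟩ := hm.exists_inv hxm
    have hu : IsUnit (1 - y * x) := (hx.mul_left_of_finite hR y).isUnit_one_sub
    exact hm.ne_top (m.eq_top_of_isUnit_mem (by rwa [← hyt, add_sub_cancel_left]) hu)
  · intro h
    obtain ⟨n, hn, he⟩ := Monoid.exists_pow_isIdempotentElem x
    refine ⟨n, ?_⟩
    have htop : Ideal.span {1 - x ^ n} = ⊤ := by
      by_contra hne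
      obtain ⟨m, hm, hle⟩ := Ideal.exists_le_maximal _ hne
      refine hm.ne_top ((Ideal.eq_top_iff_one m).2 ?_)
      have h1 : 1 - x ^ n ∈ m := hle (Ideal.subset_span rfl)
      have h2 : x ^ n ∈ m := m.pow_mem_of_mem (h m hm) n (Nat.pos_of_ne_zero hn)
      simpa using m.add_mem h1 h2
    obtain ⟨r, hr⟩ := Ideal.mem_span_singleton'.1 ((Ideal.eq_top_iff_one _).1 htop)
    have he' : x ^ n * x ^ n = x ^ n := he
    calc x ^ n = r * (1 - x ^ n) * x ^ n := by rw [hr, one_mul]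
      _ = 0 := by rw [mul_assoc, sub_mul, he', one_mul, sub_self, mul_zero]

theorem Ideal.IsMaximal.isTwoSided_of_finite
    (hR : ∀ e : R, IsIdempotentElem e → e ∈ Subring.center R) {m : Ideal R} (hm : m.IsMaximal) :
    m.IsTwoSided := by
  refine ⟨fun {y} x hy => ?_⟩
  obtain ⟨n, hn, he⟩ := Monoid.exists_pow_isIdempotentElem y
  have hc := Subring.mem_center_iff.1 (hR _ he)
  have h1 : y * (1 - y ^ n) * x ∈ m :=
    (isNilpotent_iff_forall_mem_isMaximal hR).1
      ((isNilpotent_mul_one_sub_pow hn he).mul_right_of_finite hR x) m hm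
  have h2 : y * x * y ^ n ∈ m :=
    m.mul_mem_left _ (m.pow_mem_of_mem hy n (Nat.pos_of_ne_zero hn))
  have : y * x = y * (1 - y ^ n) * x + y * x * y ^ n := by
    rw [mul_assoc y x, hc x]; noncomm_ring
  rw [this]
  exact m.add_mem h1 h2

/-- Modulo `m`, each `a` agrees with `a * e` for a central idempotent power `e` of `a`. This
excludes zero divisors, and Wedderburn's little theorem applies. -/
theorem Ideal.IsMaximal.mul_sub_mul_mem_of_finite
    (hR : ∀ e : R, IsIdempotentElem e → e ∈ Subring.center R) {m : Ideal R} (hm : m.IsMaximal)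
    (x y : R) : x * y - y * x ∈ m := by
  have := hm.isTwoSided_of_finite hR
  have hnt : Nontrivial (R ⧸ m) := Ideal.Quotient.nontrivial_iff.2 hm.ne_top
  have hnzd : NoZeroDivisors (R ⧸ m) := by
    refine ⟨fun {a b} hab => ?_⟩
    obtain ⟨a, rfl⟩ := Ideal.Quotient.mk_surjective a
    obtain ⟨b, rfl⟩ := Ideal.Quotient.mk_surjective b
    rw [or_iff_not_imp_left, Ideal.Quotient.eq_zero_iff_mem, Ideal.Quotient.eq_zero_iff_mem]
    rw [← map_mul, Ideal.Quotient.eq_zero_iff_mem] at hab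
    intro ha
    obtain ⟨n, hn, he⟩ := Monoid.exists_pow_isIdempotentElem a
    have hc := Subring.mem_center_iff.1 (hR _ he)
    have hnil : a * (1 - a ^ n) ∈ m :=
      (isNilpotent_iff_forall_mem_isMaximal hR).1 (isNilpotent_mul_one_sub_pow hn he) m hm
    have hen : a ^ n ∉ m := fun hmem => ha (by
      have : a = a * (1 - a ^ n) + a * a ^ n := by noncomm_ring
      rw [this]
      exact m.add_mem hnil (m.mul_mem_left _ hmem))
    obtain ⟨r, t, ht, hrt⟩ := hm.exists_inv hen
    have h1 : b * (1 - a ^ n) ∈ m := by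
      have : b * (1 - a ^ n) = b * (1 - a ^ n) * t := by
        have h0 : (1 - a ^ n) * (r * a ^ n) = 0 := by
          rw [hc r, ← mul_assoc, sub_mul, he.eq, one_mul, sub_self, zero_mul]
        calc b * (1 - a ^ n) = b * ((1 - a ^ n) * (r * a ^ n + t)) := by rw [hrt, mul_one]
          _ = b * (1 - a ^ n) * t := by rw [mul_add, h0, zero_add, mul_assoc]
      rw [this]
      exact m.mul_mem_left _ ht
    have h2 : b * a ^ n ∈ m := by
      obtain ⟨k, rfl⟩ := Nat.exists_eq_succ_of_ne_zero hn
      rw [hc b, _root_.pow_succ, mul_assoc]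
      exact m.mul_mem_left _ hab
    have : b = b * (1 - a ^ n) + b * a ^ n := by noncomm_ring
    rw [this]
    exact m.add_mem h1 h2
  have : IsDomain (R ⧸ m) := NoZeroDivisors.to_isDomain _
  have : Finite (R ⧸ m) := Finite.of_surjective _ (Ideal.Quotient.mk_surjective (I := m))
  rw [← Ideal.Quotient.eq_zero_iff_mem, map_sub, map_mul, map_mul, sub_eq_zero]
  exact (Finite.isDomain_to_isField (R ⧸ m)).mul_comm _ _

end FiniteRing

/-! ### Centers and augmentation of group algebras; class at most 2 -/

namespace MonoidAlgebra

theorem mem_center_iff_coeff_mul_comm {F G : Type*} [CommRing F] [Group G]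
    {x : MonoidAlgebra F G} :
    x ∈ Subring.center (MonoidAlgebra F G) ↔ ∀ a b : G, x.coeff (a * b) = x.coeff (b * a) := by
  rw [Subring.mem_center_iff]
  constructor
  · intro h a b
    have := congrArg (fun y => y.coeff b) (h (single a⁻¹ 1))
    simpa using this
  · intro h y
    induction y using MonoidAlgebra.induction_linear with
    | zero => simp
    | add y z hy hz => rw [add_mul, mul_add, hy, hz]
    | single g r =>
      ext b
      rw [coeff_single_mul_apply, coeff_mul_single_apply, h, mul_comm]

theorem coeff_mem_center {A H : Type*} [Ring A] [Group H] {x : MonoidAlgebra A H}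
    (hx : x ∈ Subring.center (MonoidAlgebra A H)) (h : H) : x.coeff h ∈ Subring.center A := by
  rw [Subring.mem_center_iff] at hx ⊢
  intro a
  simpa using congrArg (fun y => y.coeff h) (hx (single 1 a))

theorem mem_center_of_coeff_mem_center {A H : Type*} [Ring A] [CommGroup H]
    {x : MonoidAlgebra A H} (hx : ∀ h, x.coeff h ∈ Subring.center A) :
    x ∈ Subring.center (MonoidAlgebra A H) := by
  rw [Subring.mem_center_iff]
  intro y
  induction y using MonoidAlgebra.induction_linear with
  | zero => simp
  | add y z hy hz => rw [add_mul, mul_add, hy, hz]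
  | single g a =>
    ext b
    rw [coeff_single_mul_apply, coeff_mul_single_apply, mul_comm g⁻¹ b,
      Subring.mem_center_iff.1 (hx _) a]

theorem isCentrallyEssential_coeff {A H : Type*} [Ring A] [Group H]
    (h : IsCentrallyEssential (MonoidAlgebra A H)) : IsCentrallyEssential A := by
  rw [isCentrallyEssential_iff] at h ⊢
  intro x hx
  obtain ⟨c, hc, hcx, h0⟩ := h (single 1 x) (by simpa [← coeff_inj] using hx)
  obtain ⟨g, hg⟩ : ∃ g, (c * single 1 x).coeff g ≠ 0 := by
    by_contra! hne
    exact h0 (by ext g; simpa using hne g)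
  have hcoeff : (c * single 1 x).coeff g = c.coeff g * x := by simp
  rw [hcoeff] at hg
  exact ⟨c.coeff g, coeff_mem_center hc g, hcoeff ▸ coeff_mem_center hcx g, hg⟩

/-- The augmentation of a group algebra. -/
noncomputable def augmentation (F G : Type*) [CommRing F] [Group G] :
    MonoidAlgebra F G →ₐ[F] F :=
  MonoidAlgebra.lift F F G 1

theorem augmentation_single {F G : Type*} [CommRing F] [Group G] (g : G) (r : F) :
    augmentation F G (single g r) = r := by
  simp [augmentation]

theorem nsmul_char_eq_zero {p : ℕ} {F G : Type*} [Field F] [CharP F p]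
    (x : MonoidAlgebra F G) : p • x = 0 := by
  rw [← Nat.cast_smul_eq_nsmul F, CharP.cast_eq_zero, zero_smul]

/-- The left annihilator of `w` is stable under `G`, so if nonzero it contains a nonzero fixed
vector. Such a vector has constant coefficients, and `w` multiplies it by its augmentation. -/
theorem eq_zero_of_mul_eq_zero_of_augmentation_ne_zero {p : ℕ} [Fact p.Prime] {F G : Type*}
    [Field F] [CharP F p] [Group G] [Finite G] (hG : IsPGroup p G) {y w : MonoidAlgebra F G}
    (hw : augmentation F G w ≠ 0) (hyw : y * w = 0) : y = 0 := by
  by_contra hy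
  let _ : DistribMulAction G (MonoidAlgebra F G) := DistribMulAction.compHom _ (MonoidAlgebra.of F G)
  have hsmul : ∀ (g : G) (x : MonoidAlgebra F G), g • x = single g 1 * x := fun _ _ => rfl
  obtain ⟨u, hu, hu0, hfix⟩ := hG.exists_fixed_ne_zero (nsmul_char_eq_zero (p := p)) hy
  have huw : u * w = 0 := by
    clear hu0 hfix
    induction hu using AddSubgroup.closure_induction with
    | mem x hx =>
      obtain ⟨g, rfl⟩ := hx
      show g • y * w = 0
      rw [hsmul, mul_assoc, hyw, mul_zero]
    | zero => rw [zero_mul]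
    | add a b _ _ ha hb => rw [add_mul, ha, hb, add_zero]
    | neg a _ ha => rw [neg_mul, ha, neg_zero]
  have hconst : ∀ g : G, u.coeff g = u.coeff 1 := by
    intro g
    have := congrArg (fun x => x.coeff g) (hfix g)
    simpa [hsmul] using this.symm
  have hmul : ∀ v : MonoidAlgebra F G, u * v = augmentation F G v • u := by
    intro v
    induction v using MonoidAlgebra.induction_linear with
    | zero => simp
    | add a b ha hb => rw [mul_add, map_add, add_smul, ha, hb]
    | single g r =>
      ext b
      rw [augmentation_single, coeff_mul_single_apply, coeff_smul_apply, hconst, hconst b,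
        smul_eq_mul, mul_comm]
  rw [hmul] at huw
  exact (smul_ne_zero hw hu0) huw

theorem isCentrallyEssential_of_nilpotencyClass_le_two {p : ℕ} [Fact p.Prime] {F G : Type*}
    [Field F] [CharP F p] [Group G] [Finite G] (hG : IsPGroup p G)
    (hcl : Group.nilpotencyClass G ≤ 2) : IsCentrallyEssential (MonoidAlgebra F G) := by
  have := hG.isNilpotent
  have hcomm : ∀ a b : G, a * b * a⁻¹ * b⁻¹ ∈ Subgroup.center G := by
    intro a b
    have htop := Subgroup.upperCentralSeries_eq_top_iff_nilpotencyClass_le.2 hcl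
    have ha : a ∈ Subgroup.upperCentralSeries G 2 := htop ▸ Subgroup.mem_top a
    rw [← Subgroup.upperCentralSeries_one]
    exact Subgroup.mem_upperCentralSeries_succ_iff.1 ha b
  rw [isCentrallyEssential_iff]
  intro x hx
  let _ : DistribMulAction (Subgroup.center G) (MonoidAlgebra F G) :=
    DistribMulAction.compHom _ ((MonoidAlgebra.of F G).comp (Subgroup.center G).subtype)
  have hsmul : ∀ (z : Subgroup.center G) (x : MonoidAlgebra F G), z • x = single (z : G) 1 * x :=
    fun _ _ => rfl
  obtain ⟨u, hu, hu0, hfix⟩ := (hG.to_subgroup (Subgroup.center G)).exists_fixed_ne_zero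
    (nsmul_char_eq_zero (p := p)) hx
  obtain ⟨s, hs, rfl⟩ : ∃ s ∈ Subring.center (MonoidAlgebra F G), s * x = u := by
    clear hfix hu0
    induction hu using AddSubgroup.closure_induction with
    | mem y hy =>
      obtain ⟨z, rfl⟩ := hy
      refine ⟨single (z : G) 1, ?_, rfl⟩
      rw [Subring.mem_center_iff]
      intro y
      ext b
      rw [coeff_single_mul_apply, coeff_mul_single_apply, mul_comm (1 : F),
        Subgroup.mem_center_iff.1 (inv_mem z.2) b]
    | zero => exact ⟨0, zero_mem _, zero_mul x⟩
    | add a b _ _ ha hb =>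
      obtain ⟨s, hs, rfl⟩ := ha
      obtain ⟨t, ht, rfl⟩ := hb
      exact ⟨s + t, add_mem hs ht, add_mul s t x⟩
    | neg a _ ha =>
      obtain ⟨s, hs, rfl⟩ := ha
      exact ⟨-s, neg_mem hs, neg_mul s x⟩
  refine ⟨s, hs, ?_, hu0⟩
  rw [mem_center_iff_coeff_mul_comm]
  intro a b
  -- Translation by the central commutator of `a` and `b` carries `b * a` to `a * b`.
  have := congrArg (fun y => y.coeff (a * b)) (hfix ⟨a * b * a⁻¹ * b⁻¹, hcomm a b⟩)
  rw [hsmul, coeff_single_mul_apply, one_mul] at this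
  rw [← this]
  congr 1
  group

end MonoidAlgebra

/-! ### Transfer across a direct product with an abelian group -/

/-- If central elements of nonzero augmentation act injectively on `M`, then every nonzero element
of `M` has a nonzero central multiple on which the center acts through the augmentation. -/
theorem exists_center_smul_eq_augmentation_smul {F A M : Type*} [Field F] [Ring A] [Algebra F A]
    [FiniteDimensional F A] [AddCommGroup M] [Module F M] [Module A M] [IsScalarTower F A M]
    (ε : A →ₐ[F] F)
    (hε : ∀ w ∈ Subring.center A, ε w ≠ 0 → ∀ m : M, w • m = 0 → m = 0) {x : M} (hx : x ≠ 0) :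
    ∃ c ∈ Subring.center A, c • x ≠ 0 ∧
      ∀ z ∈ Subring.center A, z • c • x = ε z • c • x := by
  let S : M → Submodule F M := fun y =>
    (Subalgebra.toSubmodule (Subalgebra.center F A)).map
      ((LinearMap.toSpanSingleton A M y).restrictScalars F)
  have hSmem : ∀ y m, m ∈ S y ↔ ∃ d ∈ Subring.center A, d • y = m := fun y m => Iff.rfl
  have hSfd : ∀ y, FiniteDimensional F (S y) := fun y => inferInstance
  -- Among nonzero central multiples `y` of `x`, minimize the dimension of `Z(A) y`.
  obtain ⟨y, ⟨⟨c, hc, rfl⟩, hy0⟩, hmin⟩ := WellFounded.has_min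
    (measure fun y : M => Module.finrank F (S y)).wf
    {y : M | (∃ c ∈ Subring.center A, c • x = y) ∧ y ≠ 0} ⟨x, ⟨1, one_mem _, one_smul A x⟩, hx⟩
  refine ⟨c, hc, hy0, ?_⟩
  have hkill : ∀ z ∈ Subring.center A, ε z = 0 → z • c • x = 0 := by
    intro z hz hεz
    by_contra hne
    have hmin' := hmin (z • c • x) ⟨⟨z * c, mul_mem hz hc, mul_smul z c x⟩, hne⟩
    have hle : S (z • c • x) ≤ S (c • x) := by
      intro m hm
      obtain ⟨d, hd, rfl⟩ := (hSmem _ _).1 hm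
      exact (hSmem _ _).2 ⟨d * z, mul_mem hd hz, mul_smul d z _⟩
    have heq := Submodule.eq_of_le_of_finrank_le hle (not_lt.1 hmin')
    have hmem : c • x ∈ S (z • c • x) := heq ▸ (hSmem _ _).2 ⟨1, one_mem _, one_smul A _⟩
    obtain ⟨d, hd, hdz⟩ := (hSmem _ _).1 hmem
    -- `1 - d * z` has augmentation 1 yet kills `c • x`.
    refine hy0 (hε (1 - d * z) (sub_mem (one_mem _) (mul_mem hd hz)) (by simp [hεz]) _ ?_)
    rw [sub_smul, one_smul, mul_smul, hdz, sub_self]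
  intro z hz
  have hm : algebraMap F A (ε z) ∈ Subring.center A :=
    Subring.mem_center_iff.2 fun a => (Algebra.commutes _ a).symm
  have := hkill (z - algebraMap F A (ε z)) (sub_mem hz hm) (by simp)
  rwa [sub_smul, sub_eq_zero, algebraMap_smul] at this

namespace MonoidAlgebra

/-- Different coefficients of `x` could require different central multipliers. Once the center acts
by scalars, any multiplier that works for a coefficient is a nonzero scalar, so all coefficients are
already central. -/
theorem isCentrallyEssential_of_coeff {p : ℕ} [Fact p.Prime] {F P H : Type*}
    [Field F] [CharP F p] [Group P] [Finite P] [CommGroup H] (hP : IsPGroup p P)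
    (h : IsCentrallyEssential (MonoidAlgebra F P)) :
    IsCentrallyEssential (MonoidAlgebra (MonoidAlgebra F P) H) := by
  rw [isCentrallyEssential_iff] at h ⊢
  intro x hx
  obtain ⟨c, hc, h0, hz⟩ := exists_center_smul_eq_augmentation_smul (augmentation F P)
    (fun w hw hwε m hwm => by
      ext1
      ext1 k
      have hk : w * m.coeff k = 0 := congrArg (fun y => y.coeff k) hwm
      rw [← Subring.mem_center_iff.1 hw] at hk
      exact eq_zero_of_mul_eq_zero_of_augmentation_ne_zero hP hwε hk) hx
  have hcx : single 1 c * x = c • x := by ext1; ext1 k; simp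
  refine ⟨single 1 c, mem_center_of_coeff_mem_center fun k => ?_,
    mem_center_of_coeff_mem_center fun k => ?_, hcx ▸ h0⟩
  · classical
    rw [coeff_single, Finsupp.single_apply]
    split_ifs
    exacts [hc, zero_mem _]
  · rw [hcx]
    by_cases hk : (c • x).coeff k = 0
    · rw [hk]; exact zero_mem _
    obtain ⟨z, hzc, hzk, hzk0⟩ := h _ hk
    have hzy : z * (c • x).coeff k = augmentation F P z • (c • x).coeff k :=
      congrArg (fun y => y.coeff k) (hz z hzc)
    rw [hzy] at hzk hzk0
    have hε : augmentation F P z ≠ 0 := fun h => hzk0 (by rw [h, zero_smul])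
    have := (Subalgebra.center F (MonoidAlgebra F P)).smul_mem hzk (augmentation F P z)⁻¹
    rwa [inv_smul_smul₀ hε] at this

theorem isCentrallyEssential_iff_of_isInternalDirectProduct {p : ℕ} [Fact p.Prime] {F G : Type*}
    [Field F] [CharP F p] [Group G] {P H : Subgroup G} [Finite P] (hP : IsPGroup p P)
    (hPH : IsInternalDirectProduct P H) [IsMulCommutative H] :
    IsCentrallyEssential (MonoidAlgebra F G) ↔ IsCentrallyEssential (MonoidAlgebra F P) := by
  obtain ⟨hPn, hHn, hinf, hsup⟩ := hPH
  have hdisj : Disjoint H P := (disjoint_iff.2 hinf).symm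
  have hcomm : ∀ (h : H) (g : P), Commute (H.subtype h) (P.subtype g) := fun h g =>
    Subgroup.commute_of_normal_of_disjoint H P hHn hPn hdisj h g h.2 g.2
  let f := H.subtype.noncommCoprod P.subtype hcomm
  have hf : Function.Bijective f := by
    constructor
    · exact (MonoidHom.noncommCoprod_injective _ _ hcomm).2
        ⟨H.subtype_injective, P.subtype_injective, by simpa using hdisj⟩
    · rw [← MonoidHom.range_eq_top, MonoidHom.noncommCoprod_range]
      simpa [sup_comm] using hsup
  let e : MonoidAlgebra F G ≃+* MonoidAlgebra (MonoidAlgebra F P) H :=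
    (mapDomainRingEquiv F (MulEquiv.ofBijective f hf).symm).trans curryRingEquiv
  let _ : CommGroup H := { mul_comm := fun a b => mul_comm' a b }
  exact ⟨fun h => isCentrallyEssential_coeff (h.of_ringEquiv e),
    fun h => (isCentrallyEssential_of_coeff hP h).of_ringEquiv e.symm⟩

end MonoidAlgebra

/-! ### The Sylow decomposition forced by central idempotents -/

open scoped commutatorElement

namespace MonoidAlgebra

/-- Descends to the prime field, where the group algebra is finite even if `F` is not. -/
theorem idempotent_mem_center_of_map_injective {K F G : Type*} [Field K] [Field F] [Group G]
    (f : K →+* F) (h : IsCentrallyEssential (MonoidAlgebra F G)) (e : MonoidAlgebra K G)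
    (he : IsIdempotentElem e) : e ∈ Subring.center (MonoidAlgebra K G) := by
  have := h.idempotent_mem_center (he.map (mapRingHom G f))
  rw [mem_center_iff_coeff_mul_comm] at this ⊢
  intro a b
  apply f.injective
  simpa using this a b

/-- The normalized sum over a finite subgroup of invertible order is idempotent, so the subgroup is
normal as soon as idempotents are central. -/
theorem normal_of_isCentrallyEssential {F G : Type*} [Field F] [Group G] (H : Subgroup G)
    [Finite H] (hcard : (Nat.card H : F) ≠ 0) (h : IsCentrallyEssential (MonoidAlgebra F G)) :
    H.Normal := by
  classical
  have := Fintype.ofFinite H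
  let s : MonoidAlgebra F G := ∑ k : H, single (k : G) 1
  have hs : ∀ k : H, single (k : G) 1 * s = s := by
    intro k
    simp only [s, Finset.mul_sum, single_mul_single, one_mul]
    exact Fintype.sum_equiv (Equiv.mulLeft k) _ _ fun _ => rfl
  have hss : s * s = (Nat.card H : F) • s := by
    conv_lhs => enter [1]; unfold s
    rw [Finset.sum_mul, Finset.sum_congr rfl fun k _ => hs k, Finset.sum_const, Finset.card_univ,
      Nat.cast_smul_eq_nsmul, Nat.card_eq_fintype_card]
  have he : IsIdempotentElem ((Nat.card H : F)⁻¹ • s) := by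
    rw [IsIdempotentElem, smul_mul_smul_comm, hss, smul_smul, mul_assoc, inv_mul_cancel₀ hcard,
      mul_one]
  have hcoeff : ∀ g : G, ((Nat.card H : F)⁻¹ • s).coeff g ≠ 0 ↔ g ∈ H := by
    intro g
    have hsg : s.coeff g = if g ∈ H then 1 else 0 := by
      simp only [s, coeff_sum, coeff_single, Finsupp.finsetSum_apply, Finsupp.single_apply]
      split_ifs with hg
      · rw [Finset.sum_eq_single ⟨g, hg⟩]
        · simp
        · intro k _ hk
          exact if_neg fun hkg : (k : G) = g => hk (Subtype.ext hkg)
        · simp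
      · exact Finset.sum_eq_zero fun k _ => if_neg fun hkg : (k : G) = g => hg (hkg ▸ k.2)
    rw [coeff_smul_apply, hsg]
    split_ifs with hg <;> simp [hg, -Nat.card_eq_fintype_card, hcard]
  have hcent := mem_center_iff_coeff_mul_comm.1 (h.idempotent_mem_center he)
  refine ⟨fun n hn g => ?_⟩
  rw [← hcoeff, hcent, ← mul_assoc, inv_mul_cancel, one_mul, hcoeff]
  exact hn

/-- The elements congruent to `1` modulo the radical of a modular group algebra in which idempotents
are central form a `p`-subgroup containing all commutators. -/
theorem exists_isPGroup_commutator_le {p : ℕ} [Fact p.Prime] {G : Type*} [Group G] [Finite G]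
    (hR : ∀ e : MonoidAlgebra (ZMod p) G, IsIdempotentElem e → e ∈ Subring.center _) :
    ∃ N : Subgroup G, IsPGroup p N ∧ commutator G ≤ N := by
  have hfin : Finite (MonoidAlgebra (ZMod p) G) := Module.finite_of_finite (ZMod p)
  have hadd : ∀ x y : MonoidAlgebra (ZMod p) G, IsNilpotent x → IsNilpotent y →
      IsNilpotent (x + y) := by
    intro x y
    simp only [isNilpotent_iff_forall_mem_isMaximal hR]
    exact fun hx hy m hm => m.add_mem (hx m hm) (hy m hm)
  let N : Subgroup G :=
    { carrier := {g | IsNilpotent (of (ZMod p) G g - 1)}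
      one_mem' := by
        show IsNilpotent (of (ZMod p) G 1 - 1)
        rw [map_one, sub_self]
        exact IsNilpotent.zero
      mul_mem' := by
        intro a b ha hb
        have : of (ZMod p) G (a * b) - 1 =
            (of (ZMod p) G a - 1) * of (ZMod p) G b + (of (ZMod p) G b - 1) := by
          rw [map_mul]; noncomm_ring
        show IsNilpotent (of (ZMod p) G (a * b) - 1)
        rw [this]
        exact hadd _ _ (ha.mul_right_of_finite hR _) hb
      inv_mem' := by
        intro a ha
        have : of (ZMod p) G a⁻¹ - 1 = -((of (ZMod p) G a - 1) * of (ZMod p) G a⁻¹) := by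
          rw [sub_mul, ← map_mul, mul_inv_cancel, map_one, one_mul, neg_sub]
        show IsNilpotent (of (ZMod p) G a⁻¹ - 1)
        rw [this]
        exact (ha.mul_right_of_finite hR _).neg }
  have hmem : ∀ g, g ∈ N ↔ IsNilpotent (of (ZMod p) G g - 1) := fun _ => Iff.rfl
  refine ⟨N, ?_, ?_⟩
  · rintro ⟨g, hg⟩
    obtain ⟨n, hn⟩ := (hmem g).1 hg
    have hchar : CharP (MonoidAlgebra (ZMod p) G) p := charP_of_injective_algebraMap
      (algebraMap (ZMod p) (MonoidAlgebra (ZMod p) G)).injective p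
    refine ⟨n, Subtype.ext ?_⟩
    have hpow : (of (ZMod p) G g - 1) ^ p ^ n = 0 :=
      pow_eq_zero_of_le (Nat.lt_pow_self (Fact.out : p.Prime).one_lt).le hn
    rw [sub_pow_char_pow_of_commute _ _ (Commute.one_right _), one_pow, sub_eq_zero, ← map_pow,
      ← map_one (of (ZMod p) G)] at hpow
    exact of_injective hpow
  · rw [commutator_def, Subgroup.commutator_le]
    intro a _ b _
    rw [hmem]
    have : of (ZMod p) G ⁅a, b⁆ - 1 =
        (of (ZMod p) G a * of (ZMod p) G b - of (ZMod p) G b * of (ZMod p) G a) *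
          of (ZMod p) G (a⁻¹ * b⁻¹) := by
      rw [sub_mul, ← map_mul, ← map_mul, ← map_mul, ← map_mul, ← map_one (of (ZMod p) G)]
      congr 2 <;> simp [commutatorElement_def, mul_assoc]
    rw [this]
    refine IsNilpotent.mul_right_of_finite hR ?_ _
    rw [isNilpotent_iff_forall_mem_isMaximal hR]
    exact fun m hm => hm.mul_sub_mul_mem_of_finite hR _ _

theorem exists_isInternalDirectProduct_of_isCentrallyEssential {p : ℕ} [Fact p.Prime]
    {F G : Type*} [Field F] [CharP F p] [Group G] [Finite G]
    (h : IsCentrallyEssential (MonoidAlgebra F G)) :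
    ∃ (P : Sylow p G) (H : Subgroup G), (∀ Q : Sylow p G, Q = P) ∧
      IsInternalDirectProduct (P : Subgroup G) H ∧ IsMulCommutative H := by
  obtain ⟨N, hN, hcN⟩ := exists_isPGroup_commutator_le (p := p)
    (idempotent_mem_center_of_map_injective (ZMod.castHom dvd_rfl F) h)
  obtain ⟨P, hNP⟩ := hN.exists_le_sylow
  have hcP : commutator G ≤ P := hcN.trans hNP
  have hPn : (P : Subgroup G).Normal := Subgroup.Normal.of_commutator_le G hcP
  obtain ⟨H, hH⟩ := Subgroup.exists_right_complement'_of_coprime P.card_coprime_index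
  have hcard : (Nat.card H : F) ≠ 0 := by
    rw [Ne, CharP.cast_eq_zero_iff F p]
    rw [← hH.symm.index_eq_card]
    exact P.not_dvd_index
  have hHn := normal_of_isCentrallyEssential H hcard h
  refine ⟨P, H, fun Q => ?_, ⟨hPn, hHn, hH.disjoint.eq_bot, hH.sup_eq_top⟩, ⟨⟨fun a b => ?_⟩⟩⟩
  · have := P.unique_of_normal hPn
    exact Subsingleton.elim _ _
  · have hmemP : ⁅(a : G), (b : G)⁆ ∈ (P : Subgroup G) :=
      hcP (Subgroup.commutator_mem_commutator (Subgroup.mem_top _) (Subgroup.mem_top _))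
    have hmemH : ⁅(a : G), (b : G)⁆ ∈ H :=
      H.mul_mem (H.mul_mem (H.mul_mem a.2 b.2) (H.inv_mem a.2)) (H.inv_mem b.2)
    have h1 : ⁅(a : G), (b : G)⁆ = 1 := Subgroup.disjoint_def.1 hH.disjoint hmemP hmemH
    exact Subtype.ext (commutatorElement_eq_one_iff_mul_comm.1 h1)

end MonoidAlgebra

/-! ### The counterexample of order `p^5` -/

/-- The semidirect product of `K[N]/(N ^ 3)` by its group `1 + a N + c N ^ 2` of principal units. -/
@[ext]
structure PrincipalUnitAffine (K : Type*) where
  /-- the coefficient of `N` in the unit -/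
  a : K
  /-- the coefficient of `N ^ 2` in the unit -/
  c : K
  /-- the constant coefficient of the translation -/
  u : K
  /-- the coefficient of `N` in the translation -/
  v : K
  /-- the coefficient of `N ^ 2` in the translation -/
  w : K

namespace PrincipalUnitAffine

instance {K : Type*} [CommRing K] : Mul (PrincipalUnitAffine K) :=
  ⟨fun x y => ⟨x.a + y.a, x.c + y.c + x.a * y.a, x.u + y.u, x.v + y.v + x.a * y.u,
    x.w + y.w + x.a * y.v + x.c * y.u⟩⟩

instance {K : Type*} [CommRing K] : One (PrincipalUnitAffine K) := ⟨⟨0, 0, 0, 0, 0⟩⟩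

instance {K : Type*} [CommRing K] : Inv (PrincipalUnitAffine K) :=
  ⟨fun x => ⟨-x.a, x.a ^ 2 - x.c, -x.u, -x.v + x.a * x.u,
    -x.w + x.a * x.v - (x.a ^ 2 - x.c) * x.u⟩⟩

theorem mul_def {K : Type*} [CommRing K] (x y : PrincipalUnitAffine K) :
    x * y = ⟨x.a + y.a, x.c + y.c + x.a * y.a, x.u + y.u, x.v + y.v + x.a * y.u,
      x.w + y.w + x.a * y.v + x.c * y.u⟩ := rfl

theorem one_def {K : Type*} [CommRing K] : (1 : PrincipalUnitAffine K) = ⟨0, 0, 0, 0, 0⟩ := rfl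

theorem inv_def {K : Type*} [CommRing K] (x : PrincipalUnitAffine K) :
    x⁻¹ = ⟨-x.a, x.a ^ 2 - x.c, -x.u, -x.v + x.a * x.u,
      -x.w + x.a * x.v - (x.a ^ 2 - x.c) * x.u⟩ := rfl

instance {K : Type*} [CommRing K] : Group (PrincipalUnitAffine K) :=
  Group.ofLeftAxioms (fun x y z => by simp only [mul_def]; ext <;> simp only <;> ring)
    (fun x => by simp only [mul_def, one_def]; ext <;> simp only <;> ring)
    (fun x => by simp only [mul_def, one_def, inv_def]; ext <;> simp only <;> ring)

/-- The coordinates of an element. -/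
def equivProd (K : Type*) : PrincipalUnitAffine K ≃ K × K × K × K × K where
  toFun x := (x.a, x.c, x.u, x.v, x.w)
  invFun x := ⟨x.1, x.2.1, x.2.2.1, x.2.2.2.1, x.2.2.2.2⟩

theorem natCard_eq (K : Type*) : Nat.card (PrincipalUnitAffine K) = Nat.card K ^ 5 := by
  rw [Nat.card_congr (equivProd K)]
  simp only [Nat.card_prod]
  ring

/-- Outside the `w`-axis, conjugacy classes are unions of cosets of that axis. In the `w`-coordinate
of a product, `a` pairs with `v` and `c` with `u`; `t` uses the partner of a nonzero coordinate of
`k`. -/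
theorem exists_mul_eq_mul_mul {K : Type*} [Field K] (k : PrincipalUnitAffine K)
    (hk : ¬(k.a = 0 ∧ k.c = 0 ∧ k.u = 0 ∧ k.v = 0)) (z : K) :
    ∃ t, t * k = k * ⟨0, 0, 0, 0, z⟩ * t := by
  by_cases ha : k.a = 0
  · by_cases hu : k.u = 0
    · by_cases hv : k.v = 0
      · have hc : k.c ≠ 0 := fun hc => hk ⟨ha, hc, hu, hv⟩
        refine ⟨⟨0, 0, -z / k.c, 0, 0⟩, ?_⟩
        simp only [mul_def]
        ext <;> simp only [ha, hu, hv] <;> first | ring1 | (field_simp; ring1)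
      · refine ⟨⟨z / k.v, 0, 0, 0, 0⟩, ?_⟩
        simp only [mul_def]
        ext <;> simp only [ha, hu] <;> first | ring1 | (field_simp; ring1)
    · refine ⟨⟨0, z / k.u, 0, 0, 0⟩, ?_⟩
      simp only [mul_def]
      ext <;> simp only [ha] <;> first | ring1 | (field_simp; ring1)
  · refine ⟨⟨0, 0, 0, -z / k.a, 0⟩, ?_⟩
    simp only [mul_def]
    ext <;> simp only <;> first | ring1 | (field_simp; ring1)

open MonoidAlgebra in
theorem not_isCentrallyEssential (p : ℕ) [Fact p.Prime] (F : Type*) [Field F] [CharP F p] :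
    ¬IsCentrallyEssential (MonoidAlgebra F (PrincipalUnitAffine (ZMod p))) := by
  rw [isCentrallyEssential_iff]
  intro h
  -- The sum over a coset of the `w`-axis. A class function `c` is constant on every coset of the
  -- axis other than the axis itself, so in `c * x` such a coset contributes `p` equal terms, hence
  -- 0.
  let x : MonoidAlgebra F (PrincipalUnitAffine (ZMod p)) :=
    ∑ z : ZMod p, single ⟨1, 0, 0, 0, z⟩ 1
  have hx : x ≠ 0 := by
    intro h0
    have := congrArg (fun y => y.coeff ⟨1, 0, 0, 0, 0⟩) h0
    classical simp [x, Finsupp.finsetSum_apply, Finsupp.single_apply] at this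
  obtain ⟨c, hc, hcx, h0⟩ := h x hx
  rw [mem_center_iff_coeff_mul_comm] at hc hcx
  have hcoeff : ∀ g : PrincipalUnitAffine (ZMod p), (c * x).coeff g =
      ∑ z : ZMod p, c.coeff (g * ⟨-1, 1, 0, 0, 0⟩ * ⟨0, 0, 0, 0, z⟩) := by
    intro g
    simp only [x, Finset.mul_sum, coeff_sum, Finsupp.finsetSum_apply, coeff_mul_single_apply,
      mul_one]
    refine Fintype.sum_equiv (Equiv.neg _) _ _ fun z => ?_
    congr 1
    simp only [mul_def, inv_def, Equiv.neg_apply]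
    ext <;> simp only <;> ring
  have hvanish : ∀ g : PrincipalUnitAffine (ZMod p),
      ¬(g.a = 1 ∧ g.c = 0 ∧ g.u = 0 ∧ g.v = 0) → (c * x).coeff g = 0 := by
    intro g hg
    rw [hcoeff, Finset.sum_congr rfl (g := fun _ => c.coeff (g * ⟨-1, 1, 0, 0, 0⟩))]
    · simp
    · intro z _
      obtain ⟨t, ht⟩ := exists_mul_eq_mul_mul (g * ⟨-1, 1, 0, 0, 0⟩) (by
        contrapose! hg
        simp only [mul_def] at hg
        grind) z
      have := hc (g * ⟨-1, 1, 0, 0, 0⟩ * ⟨0, 0, 0, 0, z⟩ * t) t⁻¹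
      rw [mul_inv_cancel_right, ← ht, inv_mul_cancel_left] at this
      exact this
  apply h0
  ext g
  by_cases hg : g.a = 1 ∧ g.c = 0 ∧ g.u = 0 ∧ g.v = 0
  · have hg' : g = ⟨0, 0, 1, 0, 0⟩ * ⟨1, 0, -1, 0, g.w⟩ := by
      obtain ⟨h1, h2, h3, h4⟩ := hg
      ext <;> simp [mul_def, h1, h2, h3, h4]
    rw [hg', hcx]
    exact hvanish _ (by simp [mul_def])
  · exact hvanish g hg

end PrincipalUnitAffine

theorem theorem1p1 (p : ℕ) [Fact p.Prime] (F : Type*) [Field F] [CharP F p] :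
    (∀ (G : Type*) [Group G] [Finite G],
      IsCentrallyEssential (MonoidAlgebra F G) ↔
        ∃ (P : Sylow p G) (H : Subgroup G),
          (∀ Q : Sylow p G, Q = P) ∧
          IsInternalDirectProduct (P : Subgroup G) H ∧
          IsMulCommutative H ∧
          IsCentrallyEssential (MonoidAlgebra F (P : Subgroup G))) ∧
    (∀ (G : Type*) [Group G] [Finite G],
      IsPGroup p G → Group.nilpotencyClass G ≤ 2 →
        IsCentrallyEssential (MonoidAlgebra F G)) ∧
    (∃ (G : Type) (_ : Group G),
      Nat.card G = p ^ 5 ∧ ¬ IsCentrallyEssential (MonoidAlgebra F G)) := by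
  refine ⟨fun G _ _ => ⟨fun h => ?_, ?_⟩, fun G _ _ hG hcl =>
    MonoidAlgebra.isCentrallyEssential_of_nilpotencyClass_le_two hG hcl,
    PrincipalUnitAffine (ZMod p), inferInstance, ?_,
    PrincipalUnitAffine.not_isCentrallyEssential p F⟩
  · obtain ⟨P, H, hP, hPH, hH⟩ :=
      MonoidAlgebra.exists_isInternalDirectProduct_of_isCentrallyEssential (p := p) h
    exact ⟨P, H, hP, hPH, hH,
      (MonoidAlgebra.isCentrallyEssential_iff_of_isInternalDirectProduct P.isPGroup' hPH).1 h⟩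
  · rintro ⟨P, H, -, hPH, hH, h⟩
    exact (MonoidAlgebra.isCentrallyEssential_iff_of_isInternalDirectProduct P.isPGroup' hPH).2 h
  · rw [PrincipalUnitAffine.natCard_eq, Nat.card_zmod]
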